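/- **Setting.** Fix a function-free first-order signature with set $\mathbf P$ of predicate symbols and set $\Delta$ of constants (standard names; $\Delta$ is the Herbrand universe). An interpretation is a set of ground atoms; $\mathcal I$ is the set of all of them. MKNF formulae extend first-order formulae by the modalities $\mathbf K$ and $\mathbf{not}$. For an interpretation $I$ and $M,N\subseteq\mathcal I$, satisfaction in $(I,M,N)$ is as in $I$ for ground atoms, is usual for $\lnot,\land$, and $(I,M,N)\models\exists x\,\phi$ iff $(I,M,N)\models\phi[c/x]$ for some $c\in\Delta$; $(I,M,N)\models\mathbf K\phi$ iff $(J,M,N)\models\phi$ for all $J\in M$; $(I,M,N)\models\mathbf{not}\,\phi$ iff $(J,M,N)\not\models\phi$ for some $J\in N$. For a set $T$ of MKNF sentences, $M\models T$ means $(I,M,M)\models\phi$ for all $\phi\in T$, $I\in M$. An MKNF interpretation is a nonempty subset of $\mathcal I$. For a first-order theory $T$, $\mathsf{mod}(T)$ is the greatest $M\subseteq\mathcal I$ with $M\models T$. A literal is a ground atom $p$ or a default literal ${\sim}p$ (with ${\sim}{\sim}p=p$). A rule $r$ has a head literal $H(r)$ and a finite set $B(r)$ of body literals; it is positive if $H(r)$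 is an atom and a fact if $B(r)=\emptyset$. A program is a set of rules. An ontology is a set of axioms $\phi$ of a description logic, each with a translation $\kappa(\phi)$ into a first-order sentence. A hybrid knowledge base is a pair $\mathcal K=\langle\mathcal O,\mathcal P\rangle$ of an ontology and a program; $\mathsf{pr}(\cdot)$ denotes the set of predicate symbols occurring in an object, with $\mathsf{pr}(\phi)=\mathsf{pr}(\kappa(\phi))$ for an axiom $\phi$. Put $\pi(p)=\mathbf Kp$, $\pi({\sim}p)=\mathbf{not}\,p$, $\pi(r)=\bigl(\bigwedge_{L\in B(r)}\pi(L)\supset\pi(H(r))\bigr)$ and $\pi(\mathcal K)=\{\mathbf K\kappa(\phi)\mid\phi\in\mathcal O\}\cup\{\pi(r)\mid r\in\mathcal P\}$. A dynamic hybrid knowledge base is a finite sequence $\mathcal K=\langle\mathcal K_i\rangle_{i<n}$, $\mathcal K_i=\langle\mathcal O_i,\mathcal P_i\rangle$. *Basic case.* For interpretations $I,J,J'$ write $J\le_I J'$ if $I\mathbin\triangle J\subseteq I\mathbin\triangle J'$, and $J<_IJ'$ if $J\le_IJ'$ but not $J'\le_IJ$. For $M,N\subseteq\mathcal I$ let $M\oplus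 N=\bigcup_{I\in M}\{J\in N\mid\text{no }J'\in N\text{ has }J'<_IJ\}$. The minimal change update model of first-order theories $\langle T_i\rangle_{i<n}$ is $(\cdots(\mathsf{mod}(T_0)\oplus\mathsf{mod}(T_1))\oplus\cdots)\oplus\mathsf{mod}(T_{n-1})$, provided it is nonempty. An interpretation $I$ is a dynamic stable model of $\langle\mathcal P_i\rangle_{i<n}$ if $I\cup\{{\sim}p\mid p\notin I\}$ is the least model, with default literals read as fresh atoms, of the program consisting of (a) all rules $r$ having an occurrence $r\in\mathcal P_i$ that is not rejected, where the occurrence is rejected if for some $j\ge i$ there is $r'\in\mathcal P_j$ with $H(r)={\sim}H(r')$ and $I\models B(r')$; and (b) the facts ${\sim}p$ for all atoms $p$ such that no rule $r$ in any $\mathcal P_i$ has $H(r)=p$ and $I\models B(r)$. An MKNF interpretation $M$ is a dynamic MKNF model of a *basic* $\mathcal K$ if either all programs $\mathcal P_i$ consist of positive facts and $M$ is the minimal change update model of $\langle\kappa(\mathcal O_i)\cup\mathcal P_i\rangle_{i<n}$ (facts being read as ground atoms), or all $\mathcal O_i$ are empty and $M=\{J\in\mathcal I\mid I\subseteq J\}$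 for some dynamic stable model $I$ of $\langle\mathcal P_i\rangle_{i<n}$. *Splitting.* A set $U\subseteq\mathbf P$ is a splitting set for $\langle\mathcal O,\mathcal P\rangle$ if $\mathsf{pr}(\phi)\cap U\ne\emptyset$ implies $\mathsf{pr}(\phi)\subseteq U$ for $\phi\in\mathcal O$, and $\mathsf{pr}(H(r))\cap U\neq\emptyset$ implies $\mathsf{pr}(r)\subseteq U$ for $r\in\mathcal P$. The bottom $b_U$ keeps the axioms and rules whose predicate symbols all lie in $U$; the top $t_U$ keeps the others. The reduct $e_U(\langle\mathcal O,\mathcal P\rangle,X)$, for $X\subseteq\mathcal I$, has ontology $t_U(\mathcal O)$ and the rules $r'$ for which some $r\in t_U(\mathcal P)$ satisfies $X\models\{\pi(L)\mid L\in B(r),\mathsf{pr}(L)\subseteq U\}$, $H(r')=H(r)$ and $B(r')=\{L\in B(r)\mid\mathsf{pr}(L)\subseteq\mathbf P\setminus U\}$. For dynamic hybrid knowledge bases these operations are applied to each member. A splitting sequence for $\mathcal K=\langle\mathcal K_i\rangle_{i<n}$ is a sequence $U=\langle U_\alpha\rangle_{\alpha<\mu}$, with $\mu>0$ an ordinal,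 of splitting sets for every $\mathcal K_i$ that is monotone, continuous ($U_\alpha=\bigcup_{\eta<\alpha}U_\eta$ for limit $\alpha<\mu$) and has union $\mathbf P$. A dynamic hybrid knowledge base is reducible relative to $V\subseteq\mathbf P$ if either all rules $r$ of all its members are positive with $\mathsf{pr}(B(r))\subseteq V$, or the ontologies of all its members are empty. $U$ is update-enabling for $\mathcal K$ if $b_{U_0}(\mathcal K)$ is reducible relative to $\emptyset$ and $t_{U_\alpha}(b_{U_{\alpha+1}}(\mathcal K))$ is reducible relative to $U_\alpha$ whenever $\alpha+1<\mu$. $\mathcal K$ is updatable if it has an update-enabling splitting sequence. An MKNF interpretation $M$ is a dynamic MKNF model of an updatable $\mathcal K$ if, for some update-enabling splitting sequence $\langle U_\alpha\rangle_{\alpha<\mu}$ for $\mathcal K$, $M=\bigcap_{\alpha<\mu}X_\alpha$ where the $X_\alpha$ are MKNF interpretations such that $X_0$ is a dynamic MKNF model of the basic $b_{U_0}(\mathcal K)$; $X_{\alpha+1}$ is a dynamic MKNF model of the basic $e_{U_\alpha}\bigl(b_{U_{\alpha+1}}(\mathcal K),\bigcap_{\eta\le\alpha}X_\eta\bigr)$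 whenever $\alpha+1<\mu$; and $X_\alpha=\mathcal I$ for limit $\alpha<\mu$. **Theorem (Principle of Primacy of New Information).** Let $\mathcal K=\langle\mathcal K_i\rangle_{i<n}$ be an updatable dynamic hybrid knowledge base with $n>0$ and let $M$ be a dynamic MKNF model of $\mathcal K$. Then $M\models\pi(\mathcal K_{n-1})$. -/

import Mathlib

namespace HybridMKNF

universe u v w x

/-- A function-free first-order signature: predicate symbols with arities, and constants.
Under the standard names assumption the constants form the Herbrand universe. -/
structure Signature where
  Pred : Type u
  arity : Pred → ℕ
  Const : Type v

/-- Terms with (de Bruijn) variables among `Fin n`. -/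
inductive Term (S : Signature.{u, v}) (n : ℕ) : Type v
  | var : Fin n → Term S n
  | const : S.Const → Term S n

/-- MKNF formulas whose free variables are among `Fin n`; in `ex φ` the bound variable is the
variable `0` of `φ`. `verum` serves as the empty conjunction. -/
inductive Formula (S : Signature.{u, v}) : ℕ → Type (max u v)
  | verum {n : ℕ} : Formula S n
  | atom {n : ℕ} (P : S.Pred) (ts : Fin (S.arity P) → Term S n) : Formula S n
  | neg {n : ℕ} (φ : Formula S n) : Formula S n
  | and {n : ℕ} (φ ψ : Formula S n) : Formula S n
  | ex {n : ℕ} (φ : Formula S (n + 1)) : Formula S n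
  | know {n : ℕ} (φ : Formula S n) : Formula S n
  | naf {n : ℕ} (φ : Formula S n) : Formula S n

abbrev Sentence (S : Signature.{u, v}) := Formula S 0

namespace Formula

variable {S : Signature.{u, v}}

/-- The predicate symbols relevant to a formula. -/
def preds : {n : ℕ} → Formula S n → Set S.Pred
  | _, verum => ∅
  | _, atom P _ => {P}
  | _, neg φ => φ.preds
  | _, and φ ψ => φ.preds ∪ ψ.preds
  | _, ex φ => φ.preds
  | _, know φ => φ.preds
  | _, naf φ => φ.preds

/-- A formula is first-order if it contains no modal operator. -/
def IsFirstOrder : {n : ℕ} → Formula S n → Prop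
  | _, verum => True
  | _, atom _ _ => True
  | _, neg φ => φ.IsFirstOrder
  | _, and φ ψ => φ.IsFirstOrder ∧ ψ.IsFirstOrder
  | _, ex φ => φ.IsFirstOrder
  | _, know _ => False
  | _, naf _ => False

/-- `imp φ ψ` is `ψ ⊂ φ`. -/
def imp {n : ℕ} (φ ψ : Formula S n) : Formula S n := neg (and φ (neg ψ))

def conj {n : ℕ} (l : List (Formula S n)) : Formula S n := l.foldr and verum

end Formula

structure GroundAtom (S : Signature.{u, v}) where
  pred : S.Pred
  args : Fin (S.arity pred) → S.Const

/-- Herbrand interpretations, as sets of ground atoms. -/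
abbrev Interp (S : Signature.{u, v}) := Set (GroundAtom S)

def GroundAtom.toSentence {S : Signature.{u, v}} (p : GroundAtom S) : Sentence S :=
  Formula.atom p.pred fun i => Term.const (p.args i)

def Term.eval {S : Signature.{u, v}} {n : ℕ} (e : Fin n → S.Const) : Term S n → S.Const
  | var i => e i
  | const c => c

/-- `Sat M N φ I e`: the MKNF structure `(I, M, N)` satisfies the sentence obtained from `φ` by
replacing each free variable `i` by the constant `e i`. -/
def Sat {S : Signature.{u, v}} (M N : Set (Interp S)) :
    {n : ℕ} → Formula S n → Interp S → (Fin n → S.Const) → Prop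
  | _, .verum, _, _ => True
  | _, .atom P ts, I, e => (⟨P, fun i => (ts i).eval e⟩ : GroundAtom S) ∈ I
  | _, .neg φ, I, e => ¬ Sat M N φ I e
  | _, .and φ ψ, I, e => Sat M N φ I e ∧ Sat M N ψ I e
  | _, .ex φ, I, e => ∃ c : S.Const, Sat M N φ I (Matrix.vecCons c e)
  | _, .know φ, _, e => ∀ J ∈ M, Sat M N φ J e
  | _, .naf φ, _, e => ∃ J ∈ N, ¬ Sat M N φ J e

/-- `M ⊨ T` for a set `T` of MKNF sentences. -/
def Models {S : Signature.{u, v}} (M : Set (Interp S)) (T : Set (Sentence S)) : Prop :=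
  ∀ φ ∈ T, ∀ I ∈ M, Sat M M φ I ![]

/-- The union of all `M` with `M ⊨ T`; this is the greatest such `M` whenever a greatest one
exists. -/
def modelSet {S : Signature.{u, v}} (T : Set (Sentence S)) : Set (Interp S) :=
  ⋃₀ {M | Models M T}

theorem Sat.congr_firstOrder {S : Signature.{u, v}} {M N M' N' : Set (Interp S)} :
    ∀ {n : ℕ} (φ : Formula S n), φ.IsFirstOrder → ∀ (I : Interp S) (e : Fin n → S.Const),
      (Sat M N φ I e ↔ Sat M' N' φ I e)
  | _, .verum, _, _, _ => Iff.rfl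
  | _, .atom _ _, _, _, _ => Iff.rfl
  | _, .neg φ, h, I, e => not_congr (Sat.congr_firstOrder φ h I e)
  | _, .and φ ψ, h, I, e =>
      and_congr (Sat.congr_firstOrder φ h.1 I e) (Sat.congr_firstOrder ψ h.2 I e)
  | _, .ex φ, h, I, e => exists_congr fun c => Sat.congr_firstOrder φ h I (Matrix.vecCons c e)
  | _, .know _, h, _, _ => h.elim
  | _, .naf _, h, _, _ => h.elim

/-- For a first-order theory the greatest `M` with `M ⊨ T` exists, and it is `modelSet T`. -/
theorem isGreatest_modelSet {S : Signature.{u, v}} (T : Set (Sentence S))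
    (hT : ∀ φ ∈ T, φ.IsFirstOrder) : IsGreatest {M | Models M T} (modelSet T) := by
  refine ⟨?_, fun M hM => Set.subset_sUnion_of_mem hM⟩
  rintro φ hφ I ⟨M, hM, hI⟩
  exact (Sat.congr_firstOrder φ (hT φ hφ) I _).1 (hM φ hφ I hI)

/-- A description logic, given by its axioms and their translation into first-order
sentences. -/
structure DescriptionLogic (S : Signature.{u, v}) where
  Axiom : Type w
  toFO : Axiom → {φ : Sentence S // φ.IsFirstOrder}

def DescriptionLogic.preds {S : Signature.{u, v}} (D : DescriptionLogic.{u, v, w} S)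
    (a : D.Axiom) : Set S.Pred := (D.toFO a).1.preds

/-- Literals: ground atoms `p` and default literals `∼p`. -/
inductive Literal (S : Signature.{u, v}) : Type (max u v)
  | pos : GroundAtom S → Literal S
  | neg : GroundAtom S → Literal S

namespace Literal

variable {S : Signature.{u, v}}

/-- Default negation of a literal; double default negation is absorbed. -/
def compl : Literal S → Literal S
  | pos p => neg p
  | neg p => pos p

def preds : Literal S → Set S.Pred
  | pos p => {p.pred}
  | neg p => {p.pred}

def HoldsIn (I : Interp S) : Literal S → Prop
  | pos p => p ∈ I
  | neg p => p ∉ I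

/-- The translation `π` of literals. -/
def toMKNF : Literal S → Sentence S
  | pos p => .know p.toSentence
  | neg p => .naf p.toSentence

end Literal

structure Rule (S : Signature.{u, v}) where
  head : Literal S
  body : Finset (Literal S)

namespace Rule

variable {S : Signature.{u, v}}

def bodyPreds (r : Rule S) : Set S.Pred := ⋃ L ∈ r.body, L.preds

def preds (r : Rule S) : Set S.Pred := r.head.preds ∪ r.bodyPreds

def IsPositive (r : Rule S) : Prop := ∃ p, r.head = .pos p

def IsFact (r : Rule S) : Prop := r.body = ∅

def BodyHolds (I : Interp S) (r : Rule S) : Prop := ∀ L ∈ r.body, L.HoldsIn I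

/-- The translation `π` of rules: `π(H(r)) ⊂ ⋀ π(B(r))`. -/
noncomputable def toMKNF (r : Rule S) : Sentence S :=
  Formula.imp (Formula.conj (r.body.toList.map Literal.toMKNF)) r.head.toMKNF

/-- The rules are conflicting: the head of one is the default negation of the head of the
other. -/
def Conflicts (r r' : Rule S) : Prop := r.head = r'.head.compl

end Rule

/-- Generalised logic programs. -/
abbrev Program (S : Signature.{u, v}) := Set (Rule S)

/-! ### Minimal change updates -/

section MinimalChange

variable {S : Signature.{u, v}}

def restrictPred (P : S.Pred) (I : Interp S) : Interp S := {p ∈ I | p.pred = P}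

/-- The difference in the interpretation of `P` between `I` and `J`. -/
def diff (P : S.Pred) (I J : Interp S) : Set (GroundAtom S) :=
  (restrictPred P I \ restrictPred P J) ∪ (restrictPred P J \ restrictPred P I)

/-- `J` is at least as close to `I` as `J'`. -/
def AtLeastAsClose (I J J' : Interp S) : Prop := ∀ P, diff P I J ⊆ diff P I J'

/-- `J` is closer to `I` than `J'`. -/
def Closer (I J J' : Interp S) : Prop := AtLeastAsClose I J J' ∧ ¬ AtLeastAsClose I J' J

/-- `M ⊕ N`. -/
def update (M N : Set (Interp S)) : Set (Interp S) :=
  ⋃ I ∈ M, {J ∈ N | ¬ ∃ J' ∈ N, Closer I J' J}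

/-- `(⋯((N₀ ⊕ N₁) ⊕ N₂) ⊕ ⋯) ⊕ Nₙ₋₁`; for the empty sequence, all interpretations. -/
def updateSeq : (n : ℕ) → (Fin n → Set (Interp S)) → Set (Interp S)
  | 0, _ => Set.univ
  | 1, N => N 0
  | n + 2, N => update (updateSeq (n + 1) fun i => N i.castSucc) (N (Fin.last (n + 1)))

/-- `M` is the minimal change update model of the sequence of first-order theories `T`. -/
def IsMinimalChangeUpdateModel {n : ℕ} (T : Fin n → Set (Sentence S)) (M : Set (Interp S)) :
    Prop :=
  M.Nonempty ∧ M = updateSeq n fun i => modelSet (T i)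

end MinimalChange

/-! ### Rule updates -/

section RuleUpdates

variable {S : Signature.{u, v}}

/-- The least model of a program in which each default literal `∼p` is read as a fresh atom;
so models are sets of literals. -/
def least (Q : Program S) : Set (Literal S) :=
  ⋂₀ {A | ∀ r ∈ Q, (∀ L ∈ r.body, L ∈ A) → r.head ∈ A}

/-- `I' = I ∪ {∼p | p ∉ I}`. -/
def extend (I : Interp S) : Set (Literal S) := {L | L.HoldsIn I}

/-- The multiset of all rules in members of a dynamic logic program, as the set of rule
occurrences: `(i, r)` is the occurrence of `r` in the `i`-th program. -/
def occurrences {n : ℕ} (Q : Fin n → Program S) : Set (Fin n × Rule S) := {o | o.2 ∈ Q o.1}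

/-- The rejected rule occurrences. -/
def rejected {n : ℕ} (Q : Fin n → Program S) (I : Interp S) : Set (Fin n × Rule S) :=
  {o | o.2 ∈ Q o.1 ∧ ∃ j, ∃ r' ∈ Q j, o.1 ≤ j ∧ o.2.Conflicts r' ∧ r'.BodyHolds I}

/-- The default assumptions, as facts `∼p`. -/
def defaults {n : ℕ} (Q : Fin n → Program S) (I : Interp S) : Program S :=
  {d | ∃ p, d = ⟨.neg p, ∅⟩ ∧ ¬ ∃ i, ∃ r ∈ Q i, r.head = .pos p ∧ r.BodyHolds I}

def IsDynamicStableModel {n : ℕ} (Q : Fin n → Program S) (I : Interp S) : Prop :=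
  extend I = least (Prod.snd '' (occurrences Q \ rejected Q I) ∪ defaults Q I)

end RuleUpdates

/-! ### Hybrid knowledge bases and splitting -/

structure HybridKB {S : Signature.{u, v}} (D : DescriptionLogic.{u, v, w} S) where
  ont : Set D.Axiom
  prog : Program S

/-- Dynamic hybrid knowledge bases `⟨K_i⟩_{i < n}`. -/
abbrev DynamicKB {S : Signature.{u, v}} (D : DescriptionLogic.{u, v, w} S) (n : ℕ) :=
  Fin n → HybridKB D

namespace HybridKB

variable {S : Signature.{u, v}} {D : DescriptionLogic.{u, v, w} S}

/-- The translation `π` of hybrid knowledge bases. -/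
def toMKNF (K : HybridKB D) : Set (Sentence S) :=
  {φ | ∃ a ∈ K.ont, φ = .know (D.toFO a).1} ∪ {φ | ∃ r ∈ K.prog, φ = r.toMKNF}

def IsSplittingSet (U : Set S.Pred) (K : HybridKB D) : Prop :=
  (∀ a ∈ K.ont, (D.preds a ∩ U).Nonempty → D.preds a ⊆ U) ∧
  (∀ r ∈ K.prog, (r.head.preds ∩ U).Nonempty → r.preds ⊆ U)

def bottom (U : Set S.Pred) (K : HybridKB D) : HybridKB D where
  ont := {a ∈ K.ont | D.preds a ⊆ U}
  prog := {r ∈ K.prog | r.preds ⊆ U}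

def top (U : Set S.Pred) (K : HybridKB D) : HybridKB D where
  ont := K.ont \ (bottom U K).ont
  prog := K.prog \ (bottom U K).prog

/-- The splitting set reduct `e_U(K, X)`. -/
def reduct (U : Set S.Pred) (K : HybridKB D) (X : Set (Interp S)) : HybridKB D where
  ont := (top U K).ont
  prog := {r' | ∃ r ∈ (top U K).prog,
    Models X {φ | ∃ L ∈ r.body, L.preds ⊆ U ∧ φ = L.toMKNF} ∧
    r'.head = r.head ∧ ∀ L, L ∈ r'.body ↔ L ∈ r.body ∧ L.preds ⊆ Uᶜ}

def IsOBased (K : HybridKB D) : Prop := ∀ r ∈ K.prog, r.IsPositive ∧ r.IsFact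

def IsPBased (K : HybridKB D) : Prop := K.ont = ∅

def IsOReducible (U : Set S.Pred) (K : HybridKB D) : Prop :=
  ∀ r ∈ K.prog, r.IsPositive ∧ r.bodyPreds ⊆ U

def IsPReducible (_U : Set S.Pred) (K : HybridKB D) : Prop := K.ont = ∅

/-- The first-order theory consisting of the translated ontology axioms together with the
positive facts of the program, read as ground atoms. -/
def foTheory (K : HybridKB D) : Set (Sentence S) :=
  {φ | ∃ a ∈ K.ont, φ = (D.toFO a).1} ∪
  {φ | ∃ r ∈ K.prog, ∃ p, r.head = .pos p ∧ r.IsFact ∧ φ = p.toSentence}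

/-- `⟨U_α⟩_{α < μ}` is a splitting sequence; only the values `U α` with `α < μ` matter. -/
structure IsSplittingSequence (μ : Ordinal.{x}) (U : Ordinal.{x} → Set S.Pred)
    (K : HybridKB D) : Prop where
  pos : 0 < μ
  splitting : ∀ α < μ, IsSplittingSet (U α) K
  mono : ∀ α β, α ≤ β → β < μ → U α ⊆ U β
  continuous : ∀ α < μ, Order.IsSuccLimit α → U α = ⋃ η < α, U η
  exhausts : (⋃ α < μ, U α) = Set.univ

end HybridKB

namespace DynamicKB

variable {S : Signature.{u, v}} {D : DescriptionLogic.{u, v, w} S} {n : ℕ}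

def bottom (U : Set S.Pred) (K : DynamicKB D n) : DynamicKB D n := fun i => (K i).bottom U

def top (U : Set S.Pred) (K : DynamicKB D n) : DynamicKB D n := fun i => (K i).top U

def reduct (U : Set S.Pred) (K : DynamicKB D n) (X : Set (Interp S)) : DynamicKB D n :=
  fun i => (K i).reduct U X

def IsSplittingSequence (μ : Ordinal.{x}) (U : Ordinal.{x} → Set S.Pred)
    (K : DynamicKB D n) : Prop := ∀ i, (K i).IsSplittingSequence μ U

def IsOBased (K : DynamicKB D n) : Prop := ∀ i, (K i).IsOBased

def IsPBased (K : DynamicKB D n) : Prop := ∀ i, (K i).IsPBased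

/-- Reducible relative to `U`: either every member is `O`-reducible, or every member is
`P`-reducible. -/
def IsReducible (U : Set S.Pred) (K : DynamicKB D n) : Prop :=
  (∀ i, (K i).IsOReducible U) ∨ (∀ i, (K i).IsPReducible U)

/-- Dynamic MKNF models of a basic dynamic hybrid knowledge base. -/
def IsBasicDynamicModel (K : DynamicKB D n) (M : Set (Interp S)) : Prop :=
  M.Nonempty ∧
  ((IsOBased K ∧ IsMinimalChangeUpdateModel (fun i => (K i).foTheory) M) ∨
   (IsPBased K ∧ ∃ I, IsDynamicStableModel (fun i => (K i).prog) I ∧ M = {J | I ⊆ J}))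

structure IsUpdateEnabling (μ : Ordinal.{x}) (U : Ordinal.{x} → Set S.Pred)
    (K : DynamicKB D n) : Prop where
  splitting : IsSplittingSequence μ U K
  zero : IsReducible ∅ (bottom (U 0) K)
  succ : ∀ α, α + 1 < μ → IsReducible (U α) (top (U α) (bottom (U (α + 1)) K))

def IsUpdatable (K : DynamicKB D n) : Prop :=
  ∃ (μ : Ordinal.{x}) (U : Ordinal.{x} → Set S.Pred), IsUpdateEnabling μ U K

/-- `⟨X_α⟩_{α < μ}` is a solution to `K` with respect to `⟨U_α⟩_{α < μ}`. -/
structure IsSolution (μ : Ordinal.{x}) (U : Ordinal.{x} → Set S.Pred) (K : DynamicKB D n)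
    (X : Ordinal.{x} → Set (Interp S)) : Prop where
  nonempty : ∀ α < μ, (X α).Nonempty
  zero : IsBasicDynamicModel (bottom (U 0) K) (X 0)
  succ : ∀ α, α + 1 < μ →
    IsBasicDynamicModel (reduct (U α) (bottom (U (α + 1)) K) (⋂ η ≤ α, X η)) (X (α + 1))
  limit : ∀ α < μ, Order.IsSuccLimit α → X α = Set.univ

def IsDynamicModelWrt (μ : Ordinal.{x}) (U : Ordinal.{x} → Set S.Pred) (K : DynamicKB D n)
    (M : Set (Interp S)) : Prop :=
  M.Nonempty ∧ ∃ X, IsSolution μ U K X ∧ M = ⋂ α < μ, X α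

/-- Dynamic MKNF models of an updatable dynamic hybrid knowledge base. -/
def IsDynamicModel (K : DynamicKB D n) (M : Set (Interp S)) : Prop :=
  ∃ (μ : Ordinal.{x}) (U : Ordinal.{x} → Set S.Pred),
    IsUpdateEnabling μ U K ∧ IsDynamicModelWrt μ U K M

end DynamicKB

end HybridMKNF

/-!
Cut the signature into the disjoint layers of predicates that a splitting sequence adds at its
stages. What is asserted at stage `α` lies in layer `α`, so membership in `X α` depends on the
interpretation of layer `α` alone: for minimal change updates because a closer interpretation can be
changed outside the layer at no cost, for dynamic stable models because their atoms are heads of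
rules. Interpretations from different stages can therefore be glued along the layers, and `X α` and
the intersection of all stages contain the same interpretations of layer `α`. Primacy at each stage,
where nothing overrides the last member, thus carries over to the intersection.
-/

namespace HybridMKNF

universe u

variable {S : Signature}

/-! ### Restriction to a set of predicate symbols -/

/-- The restriction `I^[V]` of the interpretation `I` to the ground atoms over `V`. -/
def restrict (V : Set S.Pred) (I : Interp S) : Interp S := I ∩ GroundAtom.pred ⁻¹' V

/-- The interpretation that agrees with `I` on `V` and with `J` elsewhere. It is used to glue
interpretations that come from sets depending on disjoint sets of predicate symbols. -/
def merge (V : Set S.Pred) (I J : Interp S) : Interp S := (GroundAtom.pred ⁻¹' V).ite I J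

theorem mem_iff_mem_of_restrict_eq {V : Set S.Pred} {I J : Interp S}
    (h : restrict V I = restrict V J) {p : GroundAtom S} (hp : p.pred ∈ V) : p ∈ I ↔ p ∈ J :=
  ⟨fun hI => (h.subset ⟨hI, hp⟩).1, fun hJ => (h.superset ⟨hJ, hp⟩).1⟩

theorem restrict_merge (V : Set S.Pred) (I J : Interp S) :
    restrict V (merge V I J) = restrict V I :=
  Set.ite_inter_self _ _ _

theorem restrict_compl_merge (V : Set S.Pred) (I J : Interp S) :
    restrict Vᶜ (merge V I J) = restrict Vᶜ J :=
  Set.ite_inter_compl_self _ _ _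

theorem restrict_restrict_of_subset {V W : Set S.Pred} (h : W ⊆ V) (I : Interp S) :
    restrict W (restrict V I) = restrict W I := by
  rw [restrict, restrict, Set.inter_assoc,
    Set.inter_eq_self_of_subset_right (Set.preimage_mono h), restrict]

theorem restrict_merge_of_disjoint {V W : Set S.Pred} (h : Disjoint V W) (I J : Interp S) :
    restrict W (merge V I J) = restrict W J := by
  have hW : W ⊆ Vᶜ := h.subset_compl_left
  rw [← restrict_restrict_of_subset hW, restrict_compl_merge, restrict_restrict_of_subset hW]

theorem forall_mem_iff_of_image_eq {β γ : Type*} {f : β → γ} {s t : Set β} (h : f '' s = f '' t)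
    {p q : β → Prop} (hpq : ∀ a b, f a = f b → (p a ↔ q b)) :
    (∀ a ∈ s, p a) ↔ ∀ b ∈ t, q b := by
  constructor
  · intro hp b hb
    obtain ⟨a, ha, hab⟩ := h.superset (Set.mem_image_of_mem f hb)
    exact (hpq a b hab).1 (hp a ha)
  · intro hq a ha
    obtain ⟨b, hb, hba⟩ := h.subset (Set.mem_image_of_mem f ha)
    exact (hpq a b hba.symm).2 (hq b hb)

theorem Sat.congr_restrict {V : Set S.Pred} {M M' N N' : Set (Interp S)}
    (hM : restrict V '' M = restrict V '' M') (hN : restrict V '' N = restrict V '' N') :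
    ∀ {n : ℕ} (φ : Formula S n), φ.preds ⊆ V → ∀ {I I' : Interp S},
      restrict V I = restrict V I' → ∀ e : Fin n → S.Const, Sat M N φ I e ↔ Sat M' N' φ I' e
  | _, .verum, _, _, _, _, _ => Iff.rfl
  | _, .atom _ _, hV, _, _, hI, _ => mem_iff_mem_of_restrict_eq hI (hV rfl)
  | _, .neg φ, hV, _, _, hI, e => not_congr (Sat.congr_restrict hM hN φ hV hI e)
  | _, .and φ ψ, hV, _, _, hI, e =>
      and_congr (Sat.congr_restrict hM hN φ (Set.subset_union_left.trans hV) hI e)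
        (Sat.congr_restrict hM hN ψ (Set.subset_union_right.trans hV) hI e)
  | _, .ex φ, hV, _, _, hI, e =>
      exists_congr fun c => Sat.congr_restrict hM hN φ hV hI (Matrix.vecCons c e)
  | _, .know φ, hV, _, _, _, e =>
      forall_mem_iff_of_image_eq hM fun _ _ hJ => Sat.congr_restrict hM hN φ hV hJ e
  | _, .naf φ, hV, _, _, _, e => by
      have hall := forall_mem_iff_of_image_eq hN fun _ _ hJ =>
        Sat.congr_restrict hM hN φ hV hJ e
      simpa only [Sat, not_forall, exists_prop] using not_congr hall

/-! ### Saturated sets of interpretations -/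

/-- `X` is saturated relative to `V`: membership in `X` depends only on the restriction of an
interpretation to `V`. -/
def IsSaturated (V : Set S.Pred) (X : Set (Interp S)) : Prop :=
  ∀ ⦃I J⦄, restrict V I = restrict V J → I ∈ X → J ∈ X

theorem isSaturated_univ (V : Set S.Pred) : IsSaturated V (Set.univ : Set (Interp S)) :=
  fun _ _ _ _ => Set.mem_univ _

theorem isSaturated_Ici {V : Set S.Pred} {I : Interp S} (hI : ∀ p ∈ I, p.pred ∈ V) :
    IsSaturated V {J | I ⊆ J} :=
  fun _ _ h hJ p hp => (mem_iff_mem_of_restrict_eq h (hI p hp)).1 (hJ hp)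

theorem image_restrict_biInter {ι : Type*} {s : Set ι} {V : ι → Set S.Pred}
    {X : ι → Set (Interp S)} (hV : s.PairwiseDisjoint V)
    (hX : ∀ i ∈ s, IsSaturated (V i) (X i)) (hne : (⋂ i ∈ s, X i).Nonempty) {i : ι}
    (hi : i ∈ s) : restrict (V i) '' (⋂ j ∈ s, X j) = restrict (V i) '' X i := by
  refine (Set.image_mono (Set.biInter_subset_of_mem hi)).antisymm ?_
  rintro _ ⟨J, hJ, rfl⟩
  obtain ⟨I, hI⟩ := hne
  refine ⟨merge (V i) J I, Set.mem_iInter₂.2 fun j hj => ?_, restrict_merge _ _ _⟩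
  obtain rfl | hij := eq_or_ne i j
  · exact hX i hi (restrict_merge _ _ _).symm hJ
  · exact hX j hj (restrict_merge_of_disjoint (hV hi hj hij) _ _).symm (Set.mem_iInter₂.1 hI j hj)

theorem mem_modelSet_iff {T : Set (Sentence S)} (hT : ∀ φ ∈ T, φ.IsFirstOrder)
    (M N : Set (Interp S)) {I : Interp S} : I ∈ modelSet T ↔ ∀ φ ∈ T, Sat M N φ I ![] := by
  constructor
  · intro hI φ hφ
    exact (Sat.congr_firstOrder φ (hT φ hφ) I _).1 ((isGreatest_modelSet T hT).1 φ hφ I hI)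
  · intro h
    refine ⟨{I}, ?_, rfl⟩
    rintro φ hφ _ rfl
    exact (Sat.congr_firstOrder φ (hT φ hφ) _ _).1 (h φ hφ)

theorem modelSet_anti : Antitone (modelSet (S := S)) :=
  fun _ _ hT => Set.sUnion_subset_sUnion fun _ hM φ hφ => hM φ (hT hφ)

theorem isSaturated_modelSet {V : Set S.Pred} {T : Set (Sentence S)}
    (hT : ∀ φ ∈ T, φ.IsFirstOrder) (hV : ∀ φ ∈ T, φ.preds ⊆ V) :
    IsSaturated V (modelSet T) := by
  intro I J h hI
  rw [mem_modelSet_iff hT ∅ ∅] at hI ⊢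
  exact fun φ hφ => (Sat.congr_restrict rfl rfl φ (hV φ hφ) h _).1 (hI φ hφ)

/-! ### Minimal change updates -/

open scoped symmDiff

theorem atLeastAsClose_iff_symmDiff_subset {I J J' : Interp S} :
    AtLeastAsClose I J J' ↔ I ∆ J ⊆ I ∆ J' := by
  have mem_diff {P : S.Pred} {A B : Interp S} {p : GroundAtom S} :
      p ∈ diff P A B ↔ p.pred = P ∧ p ∈ A ∆ B := by
    simp only [diff, restrictPred, Set.mem_union, Set.mem_sdiff, Set.mem_ofPred_eq,
      Set.mem_symmDiff]
    tauto
  refine ⟨fun h p hp => (mem_diff.1 (h p.pred (mem_diff.2 ⟨rfl, hp⟩))).2, fun h P p hp => ?_⟩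
  rw [mem_diff] at hp ⊢
  exact ⟨hp.1, h hp.2⟩

theorem atLeastAsClose_iff_restrict (V : Set S.Pred) {I J J' : Interp S} :
    AtLeastAsClose I J J' ↔
      restrict V I ∆ restrict V J ⊆ restrict V I ∆ restrict V J' ∧
        restrict Vᶜ I ∆ restrict Vᶜ J ⊆ restrict Vᶜ I ∆ restrict Vᶜ J' := by
  simp only [atLeastAsClose_iff_symmDiff_subset, restrict, ← Set.inter_symmDiff_distrib_right,
    Set.preimage_compl]
  refine ⟨fun h => ⟨Set.inter_subset_inter_left _ h, Set.inter_subset_inter_left _ h⟩, fun h => ?_⟩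
  rw [← Set.inter_union_compl (I ∆ J) (GroundAtom.pred ⁻¹' V)]
  exact Set.union_subset (h.1.trans Set.inter_subset_left) (h.2.trans Set.inter_subset_left)

theorem Closer.merge {V : Set S.Pred} {I J J' L : Interp S} (hJ : restrict V J = restrict V J')
    (h : Closer (merge V I J') L J') : Closer I (merge V L J) J := by
  simp only [Closer, atLeastAsClose_iff_restrict V, restrict_merge, restrict_compl_merge,
    symmDiff_self, hJ] at h ⊢
  exact ⟨⟨h.1.1, subset_rfl⟩, fun hle => h.2 ⟨hle.1, bot_le⟩⟩

theorem IsSaturated.update {V : Set S.Pred} {M N : Set (Interp S)} (hM : IsSaturated V M)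
    (hN : IsSaturated V N) : IsSaturated V (update M N) := by
  intro J J' h hJ
  simp only [HybridMKNF.update, Set.mem_iUnion₂] at hJ ⊢
  obtain ⟨I, hI, hJN, hmin⟩ := hJ
  refine ⟨merge V I J', hM (restrict_merge V I J').symm hI, hN h hJN, ?_⟩
  rintro ⟨L, hL, hcloser⟩
  exact hmin ⟨merge V L J, hN (restrict_merge V L J).symm hL, hcloser.merge h⟩

theorem isSaturated_updateSeq {V : Set S.Pred} : ∀ {n : ℕ} {N : Fin n → Set (Interp S)},
    (∀ i, IsSaturated V (N i)) → IsSaturated V (updateSeq n N)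
  | 0, _, _ => isSaturated_univ V
  | 1, _, h => h 0
  | _ + 2, _, h => (isSaturated_updateSeq fun i => h i.castSucc).update (h _)

theorem updateSeq_subset_of_isTop : ∀ {n : ℕ} (N : Fin n → Set (Interp S)) {i : Fin n},
    IsTop i → updateSeq n N ⊆ N i
  | 0, _, i, _ => i.elim0
  | 1, N, i, _ => by rw [Subsingleton.elim i 0]; exact subset_rfl
  | n + 2, N, i, hi => by
      rw [(Fin.le_last i).antisymm (hi _)]
      exact Set.iUnion₂_subset fun _ _ => Set.sep_subset _ _

/-! ### Dynamic stable models -/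

theorem exists_head_of_mem_least {Q : Program S} {L : Literal S} (hL : L ∈ least Q) :
    ∃ r ∈ Q, r.head = L :=
  hL {L | ∃ r ∈ Q, r.head = L} fun r hr _ => ⟨r, hr, rfl⟩

theorem Literal.compl_compl (L : Literal S) : L.compl.compl = L := by cases L <;> rfl

theorem Literal.holdsIn_compl_iff {I : Interp S} {L : Literal S} :
    L.compl.HoldsIn I ↔ ¬ L.HoldsIn I := by
  cases L with
  | pos p => exact Iff.rfl
  | neg p => exact not_not.symm

theorem IsDynamicStableModel.exists_head_of_mem {n : ℕ} {Q : Fin n → Program S} {I : Interp S}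
    (h : IsDynamicStableModel Q I) {p : GroundAtom S} (hp : p ∈ I) :
    ∃ i, ∃ r ∈ Q i, r.head = .pos p := by
  have hleast : Literal.pos p ∈ least _ := h.subset hp
  obtain ⟨r, ⟨⟨i, r⟩, ⟨hr, -⟩, rfl⟩ | ⟨q, rfl, -⟩, hhead⟩ := exists_head_of_mem_least hleast
  · exact ⟨i, r, hr, hhead⟩
  · cases hhead

/-- A rule of the last program rejects all rules, and blocks the default assumption, from which the
complement of its head could be derived. -/
theorem IsDynamicStableModel.head_holdsIn {n : ℕ} {Q : Fin n → Program S} {I : Interp S}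
    (h : IsDynamicStableModel Q I) {i : Fin n} (hi : IsTop i) {r : Rule S} (hr : r ∈ Q i)
    (hbody : r.BodyHolds I) : r.head.HoldsIn I := by
  by_contra hhead
  have hleast : r.head.compl ∈ least _ := h.subset (Literal.holdsIn_compl_iff.2 hhead)
  obtain ⟨s, ⟨⟨j, s⟩, ⟨hs, hnot⟩, rfl⟩ | ⟨q, rfl, hq⟩, hconfl⟩ :=
    exists_head_of_mem_least hleast
  · exact hnot ⟨hs, i, r, hr, hi j, hconfl, hbody⟩
  · have hpos : r.head = .pos q := by rw [← r.head.compl_compl, ← hconfl, Literal.compl]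
    exact hq ⟨i, r, hr, hpos, hbody⟩

/-! ### Satisfaction of literals, rules and knowledge bases -/

/-- The predicate symbol of a literal. -/
def Literal.pred : Literal S → S.Pred
  | .pos p => p.pred
  | .neg p => p.pred

theorem Literal.preds_eq_singleton (L : Literal S) : L.preds = {L.pred} := by cases L <;> rfl

theorem Literal.preds_subset_iff {L : Literal S} {V : Set S.Pred} : L.preds ⊆ V ↔ L.pred ∈ V := by
  rw [preds_eq_singleton, Set.singleton_subset_iff]

theorem Literal.preds_toMKNF (L : Literal S) : L.toMKNF.preds = L.preds := by cases L <;> rfl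

theorem Rule.preds_subset_of_mem_body {r : Rule S} {L : Literal S} (hL : L ∈ r.body) :
    L.preds ⊆ r.preds :=
  (Set.subset_biUnion_of_mem (u := Literal.preds) hL).trans Set.subset_union_right

/-- `X ⊨ π(L)`, written out for nonempty `X`. -/
def Literal.IsTrueIn (X : Set (Interp S)) : Literal S → Prop
  | .pos p => ∀ J ∈ X, p ∈ J
  | .neg p => ∃ J ∈ X, p ∉ J

/-- `X ⊨ π(r)`, written out for nonempty `X`. -/
def Rule.IsTrueIn (X : Set (Interp S)) (r : Rule S) : Prop :=
  (∀ L ∈ r.body, L.IsTrueIn X) → r.head.IsTrueIn X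

theorem sat_toMKNF_literal {X : Set (Interp S)} {L : Literal S} {I : Interp S}
    {e : Fin 0 → S.Const} : Sat X X L.toMKNF I e ↔ L.IsTrueIn X := by
  cases L <;> exact Iff.rfl

theorem sat_conj {M N : Set (Interp S)} {n : ℕ} {l : List (Formula S n)} {I : Interp S}
    {e : Fin n → S.Const} : Sat M N (Formula.conj l) I e ↔ ∀ φ ∈ l, Sat M N φ I e := by
  induction l with
  | nil => exact iff_of_true trivial (List.forall_mem_nil _)
  | cons φ l ih => rw [List.forall_mem_cons, ← ih]; rfl

theorem sat_toMKNF_rule {X : Set (Interp S)} {r : Rule S} {I : Interp S} {e : Fin 0 → S.Const} :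
    Sat X X r.toMKNF I e ↔ r.IsTrueIn X := by
  simp only [Rule.toMKNF, Formula.imp, Sat, sat_conj, List.forall_mem_map, Finset.mem_toList,
    sat_toMKNF_literal, not_and, not_not, Rule.IsTrueIn]

theorem Literal.isTrueIn_congr {V : Set S.Pred} {X Y : Set (Interp S)}
    (h : restrict V '' X = restrict V '' Y) {L : Literal S} (hL : L.preds ⊆ V) :
    L.IsTrueIn X ↔ L.IsTrueIn Y := by
  rw [← L.preds_toMKNF] at hL
  simpa only [sat_toMKNF_literal] using Sat.congr_restrict h h L.toMKNF hL (I := ∅) rfl ![]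

theorem Rule.isTrueIn_congr {V : Set S.Pred} {X Y : Set (Interp S)}
    (h : restrict V '' X = restrict V '' Y) {r : Rule S} (hr : r.preds ⊆ V) :
    r.IsTrueIn X ↔ r.IsTrueIn Y :=
  imp_congr
    (forall₂_congr fun _ hL => Literal.isTrueIn_congr h ((preds_subset_of_mem_body hL).trans hr))
    (Literal.isTrueIn_congr h (Set.subset_union_left.trans hr))

theorem Literal.isTrueIn_Ici_iff {I : Interp S} {L : Literal S} :
    L.IsTrueIn {J | I ⊆ J} ↔ L.HoldsIn I := by
  cases L with
  | pos p => exact ⟨fun h => h I (Set.Subset.refl I), fun h _ hJ => hJ h⟩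
  | neg p => exact ⟨fun ⟨_, hJ, hp⟩ hI => hp (hJ hI), fun h => ⟨I, Set.Subset.refl I, h⟩⟩

variable {D : DescriptionLogic S}

theorem subset_modelSet_axiom_iff {M N X : Set (Interp S)} {a : D.Axiom} :
    X ⊆ modelSet {(D.toFO a).1} ↔ ∀ J ∈ X, Sat M N (D.toFO a).1 J ![] := by
  refine forall₂_congr fun J _ => ?_
  rw [mem_modelSet_iff (by rintro _ rfl; exact (D.toFO a).2) M N]
  simp only [Set.mem_singleton_iff, forall_eq]

theorem HybridKB.models_toMKNF_iff {K : HybridKB D} {X : Set (Interp S)} (hX : X.Nonempty) :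
    Models X K.toMKNF ↔
      (∀ a ∈ K.ont, X ⊆ modelSet {(D.toFO a).1}) ∧ ∀ r ∈ K.prog, r.IsTrueIn X := by
  obtain ⟨I, hI⟩ := hX
  constructor
  · refine fun h => ⟨fun a ha => ?_, fun r hr => ?_⟩
    · exact subset_modelSet_axiom_iff.2 (h _ (.inl ⟨a, ha, rfl⟩) I hI)
    · exact sat_toMKNF_rule.1 (h _ (.inr ⟨r, hr, rfl⟩) I hI)
  · rintro ⟨hont, hprog⟩ _ (⟨a, ha, rfl⟩ | ⟨r, hr, rfl⟩) J -
    · exact subset_modelSet_axiom_iff.1 (hont a ha)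
    · exact sat_toMKNF_rule.2 (hprog r hr)

theorem HybridKB.isTrueIn_head_of_reduct {U : Set S.Pred} {K : HybridKB D}
    {X Y : Set (Interp S)} (hX : ∀ r ∈ (K.reduct U Y).prog, r.IsTrueIn X) {r : Rule S}
    (hr : r ∈ (K.top U).prog) (hlower : ∀ L ∈ r.body, L.preds ⊆ U → L.IsTrueIn Y)
    (hupper : ∀ L ∈ r.body, L.preds ⊆ Uᶜ → L.IsTrueIn X) : r.head.IsTrueIn X := by
  classical
  let r' : Rule S := ⟨r.head, {L ∈ r.body | L.preds ⊆ Uᶜ}⟩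
  have hr' : r' ∈ (K.reduct U Y).prog := by
    refine ⟨r, hr, ?_, rfl, fun L => Finset.mem_filter⟩
    rintro _ ⟨L, hL, hLU, rfl⟩ J -
    exact sat_toMKNF_literal.2 (hlower L hL hLU)
  refine hX r' hr' fun L hL => ?_
  obtain ⟨hL, hLU⟩ := Finset.mem_filter.1 hL
  exact hupper L hL hLU

/-! ### Basic dynamic hybrid knowledge bases -/

theorem HybridKB.isFirstOrder_of_mem_foTheory {K : HybridKB D} :
    ∀ φ ∈ K.foTheory, φ.IsFirstOrder := by
  rintro _ (⟨a, -, rfl⟩ | ⟨_, -, _, -, -, rfl⟩)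
  · exact (D.toFO a).2
  · trivial

/-- What `K` asserts, namely its axioms and the heads of its rules, is over `V`. Rule bodies are
unconstrained. -/
def HybridKB.AssertsOver (V : Set S.Pred) (K : HybridKB D) : Prop :=
  (∀ a ∈ K.ont, D.preds a ⊆ V) ∧ ∀ r ∈ K.prog, r.head.preds ⊆ V

theorem HybridKB.AssertsOver.preds_subset_of_mem_foTheory {V : Set S.Pred} {K : HybridKB D}
    (hK : K.AssertsOver V) : ∀ φ ∈ K.foTheory, φ.preds ⊆ V := by
  rintro _ (⟨a, ha, rfl⟩ | ⟨r, hr, p, hp, -, rfl⟩)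
  · exact hK.1 a ha
  · have hhead := hK.2 r hr
    rwa [hp] at hhead

namespace DynamicKB

variable {n : ℕ}

theorem IsBasicDynamicModel.isSaturated {K : DynamicKB D n} {X : Set (Interp S)}
    (h : IsBasicDynamicModel K X) {V : Set S.Pred} (hK : ∀ i, (K i).AssertsOver V) :
    IsSaturated V X := by
  obtain ⟨-, ⟨-, -, rfl⟩ | ⟨-, I, hI, rfl⟩⟩ := h
  · exact isSaturated_updateSeq fun i =>
      isSaturated_modelSet HybridKB.isFirstOrder_of_mem_foTheory
        (hK i).preds_subset_of_mem_foTheory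
  · refine isSaturated_Ici fun p hp => ?_
    obtain ⟨i, r, hr, hhead⟩ := hI.exists_head_of_mem hp
    have hpreds := (hK i).2 r hr
    rwa [hhead, Literal.preds_subset_iff] at hpreds

theorem IsBasicDynamicModel.models_of_isTop {K : DynamicKB D n} {X : Set (Interp S)}
    (h : IsBasicDynamicModel K X) {i : Fin n} (hi : IsTop i) : Models X (K i).toMKNF := by
  rw [HybridKB.models_toMKNF_iff h.1]
  obtain ⟨-, ⟨hfacts, -, rfl⟩ | ⟨hont, I, hI, rfl⟩⟩ := h
  · have hX := updateSeq_subset_of_isTop (fun j => modelSet (K j).foTheory) hi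
    refine ⟨fun a ha => hX.trans (modelSet_anti ?_), fun r hr _ => ?_⟩
    · exact Set.singleton_subset_iff.2 (.inl ⟨a, ha, rfl⟩)
    · obtain ⟨⟨p, hp⟩, hfact⟩ := hfacts i r hr
      rw [hp]
      exact fun J hJ => (mem_modelSet_iff HybridKB.isFirstOrder_of_mem_foTheory ∅ ∅).1 (hX hJ)
        p.toSentence (.inr ⟨r, hr, p, hp, hfact, rfl⟩)
  · refine ⟨fun a ha => (Set.eq_empty_iff_forall_notMem.1 (hont i) a ha).elim, ?_⟩
    intro r hr hbody
    rw [Literal.isTrueIn_Ici_iff]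
    exact hI.head_holdsIn hi hr fun L hL => Literal.isTrueIn_Ici_iff.1 (hbody L hL)

end DynamicKB

/-! ### Layers of a splitting sequence -/

/-- The elements that enter the sequence `U` of sets at stage `i`. -/
def layer {ι σ : Type*} [LT ι] (U : ι → Set σ) (i : ι) : Set σ := {P ∈ U i | ∀ j < i, P ∉ U j}

theorem pairwise_disjoint_layer {ι σ : Type*} [LinearOrder ι] (U : ι → Set σ) :
    Pairwise (Function.onFun Disjoint (layer U)) :=
  fun i j hij => Set.disjoint_left.2 fun _ hi hj =>
    hij.lt_or_gt.elim (fun h => hj.2 i h hi.1) fun h => hi.2 j h hj.1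

theorem exists_mem_layer_le {ι σ : Type*} [Preorder ι] [WellFoundedLT ι] {U : ι → Set σ} {i : ι}
    {P : σ} (hP : P ∈ U i) : ∃ j ≤ i, P ∈ layer U j := by
  obtain ⟨j, hji, hj⟩ := exists_minimal_le_of_wellFoundedLT (P ∈ U ·) i hP
  exact ⟨j, hji, hj.prop, fun _ => hj.not_prop_of_lt⟩

theorem layer_of_isMin {ι σ : Type*} [Preorder ι] (U : ι → Set σ) {i : ι} (hi : IsMin i) :
    layer U i = U i :=
  Set.sep_eq_self_iff_mem_true.2 fun _ _ _ h => (hi.not_lt h).elim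

namespace HybridKB

variable {K : HybridKB D} {μ : Ordinal.{u}} {U : Ordinal.{u} → Set S.Pred}

theorem IsSplittingSequence.layer_add_one (h : K.IsSplittingSequence μ U) {α : Ordinal.{u}}
    (hα : α + 1 < μ) : layer U (α + 1) = U (α + 1) \ U α := by
  have hlt : α < α + 1 := Order.lt_add_one_iff.2 le_rfl
  ext P
  exact ⟨fun hP => ⟨hP.1, hP.2 α hlt⟩, fun hP => ⟨hP.1, fun η hη hPη =>
    hP.2 (h.mono η α (Order.lt_add_one_iff.1 hη) (hlt.trans hα) hPη)⟩⟩

theorem IsSplittingSequence.mem_zero_or_exists_mem_diff (h : K.IsSplittingSequence μ U)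
    (P : S.Pred) : P ∈ U 0 ∨ ∃ α, α + 1 < μ ∧ P ∈ U (α + 1) \ U α := by
  have hP : P ∈ ⋃ α < μ, U α := h.exhausts ▸ Set.mem_univ P
  obtain ⟨β, hβ, hPβ⟩ := Set.mem_iUnion₂.1 hP
  obtain ⟨α, hαβ, hPα⟩ := exists_mem_layer_le hPβ
  have hα : α < μ := hαβ.trans_lt hβ
  rcases α.zero_or_succ_or_isSuccLimit with rfl | ⟨γ, rfl⟩ | hlim
  · exact .inl hPα.1
  · exact .inr ⟨γ, hα, h.layer_add_one hα ▸ hPα⟩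
  · have hPlim := hPα.1
    rw [h.continuous α hα hlim] at hPlim
    obtain ⟨η, hη, hPη⟩ := Set.mem_iUnion₂.1 hPlim
    exact (hPα.2 η hη hPη).elim

theorem assertsOver_bottom (U : Set S.Pred) (K : HybridKB D) : (K.bottom U).AssertsOver U :=
  ⟨fun _ ha => ha.2, fun _ hr => Set.subset_union_left.trans hr.2⟩

theorem IsSplittingSet.assertsOver_reduct_bottom {U V : Set S.Pred} (h : K.IsSplittingSet U)
    (Y : Set (Interp S)) : ((K.bottom V).reduct U Y).AssertsOver (V \ U) := by
  refine ⟨fun a ha P hP => ⟨ha.1.2 hP, fun hPU => ?_⟩, ?_⟩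
  · exact ha.2 ⟨ha.1, h.1 a ha.1.1 ⟨P, hP, hPU⟩⟩
  · rintro r' ⟨r, hr, -, hhead, -⟩ P hP
    rw [hhead] at hP
    exact ⟨hr.1.2 (.inl hP), fun hPU => hr.2 ⟨hr.1, h.2 r hr.1.1 ⟨P, hP, hPU⟩⟩⟩

end HybridKB

/-! ### Solutions -/

namespace DynamicKB

variable {n : ℕ} {K : DynamicKB D n} {μ : Ordinal.{u}} {U : Ordinal.{u} → Set S.Pred}
  {X : Ordinal.{u} → Set (Interp S)}

theorem IsSolution.isSaturated_layer (hX : IsSolution μ U K X) (hU : IsSplittingSequence μ U K)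
    {α : Ordinal.{u}} (hα : α < μ) : IsSaturated (layer U α) (X α) := by
  rcases α.zero_or_succ_or_isSuccLimit with rfl | ⟨γ, rfl⟩ | hlim
  · rw [layer_of_isMin U isBot_zero.isMin]
    exact hX.zero.isSaturated fun i => (K i).assertsOver_bottom (U 0)
  · refine (hX.succ γ hα).isSaturated fun i => ?_
    have hγ : γ < μ := (Order.lt_succ γ).trans hα
    rw [Order.succ_eq_add_one, (hU i).layer_add_one hα]
    exact ((hU i).splitting γ hγ).assertsOver_reduct_bottom _
  · rw [hX.limit α hα hlim]
    exact isSaturated_univ _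

theorem IsSolution.image_restrict_biInter (hX : IsSolution μ U K X)
    (hU : IsSplittingSequence μ U K) {s : Set Ordinal.{u}} (hs : ∀ α ∈ s, α < μ)
    (hne : (⋂ α ∈ s, X α).Nonempty) {α : Ordinal.{u}} (hα : α ∈ s) :
    restrict (layer U α) '' (⋂ β ∈ s, X β) = restrict (layer U α) '' X α :=
  HybridMKNF.image_restrict_biInter ((pairwise_disjoint_layer U).set_pairwise s)
    (fun β hβ => hX.isSaturated_layer hU (hs β hβ)) hne hα

theorem IsSolution.isTrueIn_biInter_le_iff (hX : IsSolution μ U K X)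
    (hU : IsSplittingSequence μ U K) (hne : (⋂ β < μ, X β).Nonempty) {α : Ordinal.{u}}
    (hα : α < μ) {L : Literal S} (hL : L.preds ⊆ U α) :
    L.IsTrueIn (⋂ β ≤ α, X β) ↔ L.IsTrueIn (⋂ β < μ, X β) := by
  have hle : ∀ β ≤ α, β < μ := fun β hβ => hβ.trans_lt hα
  have hsub : ⋂ β < μ, X β ⊆ ⋂ β ≤ α, X β := Set.biInter_mono hle fun _ _ => subset_rfl
  obtain ⟨β, hβ, hLβ⟩ := exists_mem_layer_le (Literal.preds_subset_iff.1 hL)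
  refine Literal.isTrueIn_congr ?_ (Literal.preds_subset_iff.2 hLβ)
  exact (hX.image_restrict_biInter hU hle (hne.mono hsub) hβ).trans
    (hX.image_restrict_biInter hU (fun _ => id) hne (hle β hβ)).symm

variable {i : Fin n}

theorem IsSolution.biInter_subset_modelSet_axiom (hX : IsSolution μ U K X)
    (hU : IsSplittingSequence μ U K) (hi : IsTop i) {a : D.Axiom} (ha : a ∈ (K i).ont) :
    ⋂ α < μ, X α ⊆ modelSet {(D.toFO a).1} := by
  suffices h : ∃ α < μ, X α ⊆ modelSet {(D.toFO a).1} by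
    obtain ⟨α, hα, hXα⟩ := h
    exact (Set.biInter_subset_of_mem hα).trans hXα
  by_cases hbot : D.preds a ⊆ U 0
  · have hmodels := hX.zero.models_of_isTop hi
    rw [HybridKB.models_toMKNF_iff hX.zero.1] at hmodels
    exact ⟨0, (hU i).pos, hmodels.1 a ⟨ha, hbot⟩⟩
  · obtain ⟨P, hP, hP0⟩ := Set.not_subset.1 hbot
    obtain ⟨α, hα, hPα⟩ := ((hU i).mem_zero_or_exists_mem_diff P).resolve_left hP0
    have hmodels := (hX.succ α hα).models_of_isTop hi
    rw [HybridKB.models_toMKNF_iff (hX.succ α hα).1] at hmodels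
    have hsub : D.preds a ⊆ U (α + 1) := ((hU i).splitting _ hα).1 a ha ⟨P, hP, hPα.1⟩
    exact ⟨α + 1, hα, hmodels.1 a ⟨⟨ha, hsub⟩, fun h => hPα.2 (h.2 hP)⟩⟩

theorem IsSolution.rule_isTrueIn_biInter (hX : IsSolution μ U K X)
    (hU : IsSplittingSequence μ U K) (hi : IsTop i) (hne : (⋂ α < μ, X α).Nonempty)
    {r : Rule S} (hr : r ∈ (K i).prog) : r.IsTrueIn (⋂ α < μ, X α) := by
  have himage {α} (hα : α < μ) :
      restrict (layer U α) '' (⋂ β < μ, X β) = restrict (layer U α) '' X α :=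
    hX.image_restrict_biInter hU (fun _ => id) hne hα
  have hpreds {α} (hα : α < μ) (hhead : r.head.pred ∈ U α) : r.preds ⊆ U α :=
    ((hU i).splitting α hα).2 r hr ⟨_, r.head.preds_eq_singleton.superset rfl, hhead⟩
  rcases (hU i).mem_zero_or_exists_mem_diff r.head.pred with hhead | ⟨α, hα, hhead⟩
  · have h0 := (hU i).pos
    have hmodels := hX.zero.models_of_isTop hi
    rw [HybridKB.models_toMKNF_iff hX.zero.1] at hmodels
    have hlayer : r.preds ⊆ layer U 0 :=
      (hpreds h0 hhead).trans (layer_of_isMin U isBot_zero.isMin).superset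
    rw [Rule.isTrueIn_congr (himage h0) hlayer]
    exact hmodels.2 r ⟨hr, hpreds h0 hhead⟩
  · intro hbody
    have hmodels := (hX.succ α hα).models_of_isTop hi
    rw [HybridKB.models_toMKNF_iff (hX.succ α hα).1] at hmodels
    have htrue {L : Literal S} (hL : L.pred ∈ U (α + 1) \ U α) :
        L.IsTrueIn (⋂ β < μ, X β) ↔ L.IsTrueIn (X (α + 1)) :=
      Literal.isTrueIn_congr (himage hα)
        (Literal.preds_subset_iff.2 ((hU i).layer_add_one hα ▸ hL))
    have hup := hpreds hα hhead.1
    rw [htrue hhead]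
    refine HybridKB.isTrueIn_head_of_reduct hmodels.2
      ⟨⟨hr, hup⟩, fun h => hhead.2 ?_⟩ (fun L hL hLU => ?_) fun L hL hLU => ?_
    · exact Literal.preds_subset_iff.1 (Set.subset_union_left.trans h.2)
    · have hαμ : α < μ := (Order.lt_add_one_iff.2 le_rfl).trans hα
      exact (hX.isTrueIn_biInter_le_iff hU hne hαμ hLU).2 (hbody L hL)
    · have hLup := (Rule.preds_subset_of_mem_body hL).trans hup
      exact (htrue ⟨Literal.preds_subset_iff.1 hLup, Literal.preds_subset_iff.1 hLU⟩).1
        (hbody L hL)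

end DynamicKB

end HybridMKNF

theorem mainTheorem7_general {S : HybridMKNF.Signature} {D : HybridMKNF.DescriptionLogic S}
    {n : ℕ} {i : Fin n} (hi : IsTop i) {K : HybridMKNF.DynamicKB D n} {μ : Ordinal}
    {U : Ordinal → Set S.Pred} (hU : HybridMKNF.DynamicKB.IsSplittingSequence μ U K)
    {M : Set (HybridMKNF.Interp S)} (hM : HybridMKNF.DynamicKB.IsDynamicModelWrt μ U K M) :
    HybridMKNF.Models M (K i).toMKNF := by
  obtain ⟨hne, X, hX, rfl⟩ := hM
  rw [HybridMKNF.HybridKB.models_toMKNF_iff hne]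
  exact ⟨fun _ ha => hX.biInter_subset_modelSet_axiom hU hi ha,
    fun _ hr => hX.rule_isTrueIn_biInter hU hi hne hr⟩

theorem mainTheorem7 {S : HybridMKNF.Signature} {D : HybridMKNF.DescriptionLogic S}
    {n : ℕ} (hn : 0 < n) (K : HybridMKNF.DynamicKB D n)
    (hK : HybridMKNF.DynamicKB.IsUpdatable K)
    (M : Set (HybridMKNF.Interp S)) (hM : HybridMKNF.DynamicKB.IsDynamicModel K M) :
    HybridMKNF.Models M (K ⟨n - 1, Nat.sub_lt hn Nat.one_pos⟩).toMKNF := by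
  obtain ⟨μ, U, hU, hM⟩ := hM
  exact mainTheorem7_general (fun j => Nat.le_sub_one_of_lt j.isLt) hU.splitting hM
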